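/- Let $n\ge 0$ and let $\mathbb{C}\mathfrak{S}_n$ be the complex vector space with basis the permutations of $\{1,\dots,n\}$; write a permutation as the word $\mu=\mu_1\cdots\mu_n$ with $\mu_i=\mu(i)$, and let $s_i$ be the transposition exchanging $i$ and $i+1$. Linear operators act on $\mathbb{C}\mathfrak{S}_n$ from the right, so that $fg$ means first $f$, then $g$. For $1\le i\le n-1$ define operators on the basis by $$\mu\cdot\sigma_i=\mu s_i,\qquad \mu\cdot\pi_i=\begin{cases}\mu&\text{if }\mu_i>\mu_{i+1},\\ \mu s_i&\text{otherwise,}\end{cases}\qquad \mu\cdot\bar\sigma_i=s_i\mu ,$$ where $\mu s_i$ is $\mu$ with the letters at positions $i,i+1$ exchanged and $s_i\mu$ is $\mu$ with the values $i,i+1$ exchanged. Let $\mathrm{H}\mathfrak{S}_n$ be the (unital) subalgebra of $\mathrm{End}(\mathbb{C}\mathfrak{S}_n)$ generated by $\sigma_1,\dots,\sigma_{n-1},\pi_1,\dots,\pi_{n-1}$. A vector $v$ is called left $i$-antisymmetric if $v\cdot\bar\sigma_i=-v$. **Theorem 3.2.** $\mathrm{H}\mathfrak{S}_n$ is the subspace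 of $\mathrm{End}(\mathbb{C}\mathfrak{S}_n)$ of all operators $f$ that satisfy the $n-1$ sandwich equations $$\tfrac12(1-\bar\sigma_i)\,f\,\tfrac12(1+\bar\sigma_i)=0\qquad\text{for } i=1,\dots,n-1 .$$ In other words, $\mathrm{H}\mathfrak{S}_n$ is exactly the set of all operators $f$ that preserve left antisymmetries, i.e. such that for every $i\in\{1,\dots,n-1\}$ and every left $i$-antisymmetric vector $v$, the vector $v\cdot f$ is left $i$-antisymmetric. -/

import Mathlib

open Equiv

noncomputable section

/-- The position (and value) `i`, for `i` among the `n - 1` indices of elementary transpositions.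
Positions and values are numbered from `0` to `n - 1`. -/
def idxLeft {n : ℕ} (i : Fin (n - 1)) : Fin n := ⟨i.1, by omega⟩

/-- The position (and value) `i + 1`. -/
def idxRight {n : ℕ} (i : Fin (n - 1)) : Fin n := ⟨i.1 + 1, by omega⟩

/-- The elementary transposition exchanging `i` and `i + 1`. -/
def elemTransp {n : ℕ} (i : Fin (n - 1)) : Perm (Fin n) := swap (idxLeft i) (idxRight i)

/-- The plain complex vector space with basis the permutations of `n` letters. -/
abbrev PermSpace (n : ℕ) : Type := Perm (Fin n) →₀ ℂ

/-- The linear extension to `PermSpace n` of a map from permutations to permutations. -/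
def linExt {n : ℕ} (φ : Perm (Fin n) → Perm (Fin n)) : Module.End ℂ (PermSpace n) :=
  Finsupp.lmapDomain ℂ ℂ φ

/-- The operator `σᵢ`: `μ ↦ μ sᵢ`, which exchanges the letters of the word
`μ(0) μ(1) ⋯ μ(n - 1)` at the positions `i` and `i + 1` (action on positions). -/
def sigmaOp {n : ℕ} (i : Fin (n - 1)) : Module.End ℂ (PermSpace n) :=
  linExt fun μ => μ * elemTransp i

/-- The decreasing sort operator `πᵢ`: it fixes `μ` if `μ(i) > μ(i + 1)`, and sends `μ` to
`μ sᵢ` otherwise. -/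
def piOp {n : ℕ} (i : Fin (n - 1)) : Module.End ℂ (PermSpace n) :=
  linExt fun μ => if μ (idxRight i) < μ (idxLeft i) then μ else μ * elemTransp i

/-- The operator `σ̄ᵢ`: `μ ↦ sᵢ μ`, which exchanges the values `i` and `i + 1`. -/
def sigmaBarOp {n : ℕ} (i : Fin (n - 1)) : Module.End ℂ (PermSpace n) :=
  linExt fun μ => elemTransp i * μ

/-- The algebra `HSₙ`: the unital subalgebra of `End(ℂSₙ)` generated by all the `σᵢ` and `πᵢ`. -/
def HSAlgebra (n : ℕ) : Subalgebra ℂ (Module.End ℂ (PermSpace n)) :=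
  Algebra.adjoin ℂ (Set.range (sigmaOp (n := n)) ∪ Set.range (piOp (n := n)))

/-- A vector is left `i`-antisymmetric if `σ̄ᵢ` maps it to its opposite. -/
def IsLeftAntisymmetric {n : ℕ} (i : Fin (n - 1)) (v : PermSpace n) : Prop :=
  sigmaBarOp i v = -v

/-- An operator preserves left antisymmetries if, for every `i`, it maps left `i`-antisymmetric
vectors to left `i`-antisymmetric vectors. -/
def PreservesLeftAntisymmetries {n : ℕ} (f : Module.End ℂ (PermSpace n)) : Prop :=
  ∀ (i : Fin (n - 1)) (v : PermSpace n), IsLeftAntisymmetric i v → IsLeftAntisymmetric i (f v)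

/-- The sandwich equation `½(1 - σ̄ᵢ) f ½(1 + σ̄ᵢ) = 0` for operators acting on the right, where
`gh` means "first `g`, then `h`". The product of `Module.End` is `g * h = g ∘ h` ("first `h`"),
so that the factors appear below in the reverse order. -/
def SandwichEq {n : ℕ} (i : Fin (n - 1)) (f : Module.End ℂ (PermSpace n)) : Prop :=
  ((1 / 2 : ℂ) • (1 + sigmaBarOp i)) * f * ((1 / 2 : ℂ) • (1 - sigmaBarOp i)) = 0

end

/-! That the algebra preserves left antisymmetries is checked on generators: `σᵢ` commutes with
`σ̄ⱼ`, and `πᵢ` either commutes with `σ̄ⱼ` at `μ` or sends `μ` and `sⱼ μ` to the same word.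

For the converse, write `W_J` for the parabolic subgroup of `J`. Antisymmetrizing each `w` on the
left over `W_D`, with `D` its left descents, gives a basis that is unitriangular for the moment and
in which the left `i`-antisymmetric vectors are spanned by the elements with `i ∈ D`
(`mem_span_descentVector`). If `f` preserves antisymmetries, its `w`-coordinate vanishes on `μ - sᵢ
μ` for `i ∉ D`, hence is constant on the cosets of the complementary parabolic subgroup. So `f` is a
combination of rank one operators, each pairing a coset indicator with a basis vector.

Right translations reduce these operators to the one sending `W_{Kᶜ}` to the antisymmetrizer of
`W_K` and everything else to 0 (`exists_parabolic_rankOne`). To build it, sort along `Kᶜ`: exactly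
the elements of `W_{Kᶜ}` become 1, and all others keep a descent in `K`. Products of factors `1 -
πᵢ` followed by the antisymmetrizer then kill every word with a descent in `K`, but not 1
(`exists_antiWeight`). -/

/-! ### The moment, a substitute for Coxeter length -/

/-- The statistic `∑ k, k * w k`, which increases when an inversion of neighbours is removed. -/
def moment {n : ℕ} (w : Perm (Fin n)) : ℕ := ∑ k : Fin n, (k : ℕ) * (w k : ℕ)

theorem moment_inv {n : ℕ} (w : Perm (Fin n)) : moment w⁻¹ = moment w := by
  unfold moment
  rw [← Equiv.sum_comp w]
  exact Finset.sum_congr rfl fun k _ => by simp [mul_comm]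

theorem apply_inv_apply {α : Type*} (w : Perm α) (a : α) : w (w⁻¹ a) = a := w.apply_symm_apply a

theorem idxLeft_lt_idxRight {n : ℕ} (i : Fin (n - 1)) : idxLeft i < idxRight i := by
  simp [idxLeft, idxRight]

theorem idxLeft_ne_idxRight {n : ℕ} (i : Fin (n - 1)) : idxLeft i ≠ idxRight i :=
  (idxLeft_lt_idxRight i).ne

@[simp] theorem elemTransp_idxLeft {n : ℕ} (i : Fin (n - 1)) :
    elemTransp i (idxLeft i) = idxRight i := swap_apply_left _ _

@[simp] theorem elemTransp_idxRight {n : ℕ} (i : Fin (n - 1)) :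
    elemTransp i (idxRight i) = idxLeft i := swap_apply_right _ _

@[simp] theorem elemTransp_mul_self {n : ℕ} (i : Fin (n - 1)) :
    elemTransp i * elemTransp i = 1 := swap_mul_self _ _

@[simp] theorem elemTransp_inv {n : ℕ} (i : Fin (n - 1)) :
    (elemTransp i)⁻¹ = elemTransp i := swap_inv _ _

@[simp] theorem mul_elemTransp_cancel {n : ℕ} (w : Perm (Fin n)) (i : Fin (n - 1)) :
    w * elemTransp i * elemTransp i = w := by rw [mul_assoc]; simp

@[simp] theorem elemTransp_mul_cancel {n : ℕ} (w : Perm (Fin n)) (i : Fin (n - 1)) :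
    elemTransp i * (elemTransp i * w) = w := by rw [← mul_assoc]; simp

@[simp] theorem sign_elemTransp {n : ℕ} (i : Fin (n - 1)) :
    Perm.sign (elemTransp i) = -1 := Perm.sign_swap (idxLeft_ne_idxRight i)

theorem moment_mul_elemTransp_lt {n : ℕ} {w : Perm (Fin n)} {i : Fin (n - 1)}
    (h : w (idxLeft i) < w (idxRight i)) : moment (w * elemTransp i) < moment w := by
  -- Only positions `i` and `i + 1` contribute, and their weights differ by 1.
  have key : ((moment w : ℤ) - moment (w * elemTransp i)) =
      (w (idxRight i) : ℤ) - w (idxLeft i) := by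
    have h1 : moment (w * elemTransp i) = ∑ k : Fin n, ((elemTransp i k : Fin n) : ℕ) * (w k : ℕ) := by
      unfold moment
      rw [← Equiv.sum_comp (elemTransp i)]
      refine Finset.sum_congr rfl fun k _ => ?_
      rw [← Perm.mul_apply, mul_elemTransp_cancel]
    rw [h1]
    unfold moment
    push_cast
    rw [← Finset.sum_sub_distrib,
      Fintype.sum_eq_add (idxLeft i) (idxRight i) (idxLeft_ne_idxRight i)]
    · simp only [elemTransp_idxLeft, elemTransp_idxRight]
      simp only [idxLeft, idxRight]
      push_cast
      ring
    · rintro k ⟨hl, hr⟩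
      simp [elemTransp, swap_apply_of_ne_of_ne hl hr]
  have : (w (idxLeft i) : ℕ) < w (idxRight i) := h
  omega

theorem moment_lt_mul_elemTransp {n : ℕ} {w : Perm (Fin n)} {i : Fin (n - 1)}
    (h : w (idxRight i) < w (idxLeft i)) : moment w < moment (w * elemTransp i) := by
  have := moment_mul_elemTransp_lt (w := w * elemTransp i) (i := i) (by simpa using h)
  simpa using this

theorem moment_elemTransp_mul_lt {n : ℕ} {w : Perm (Fin n)} {i : Fin (n - 1)}
    (h : w⁻¹ (idxLeft i) < w⁻¹ (idxRight i)) : moment (elemTransp i * w) < moment w := by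
  rw [← moment_inv w, ← moment_inv (elemTransp i * w), mul_inv_rev, elemTransp_inv]
  exact moment_mul_elemTransp_lt h

theorem apply_lt_or_gt {n : ℕ} (w : Perm (Fin n)) (i : Fin (n - 1)) :
    w (idxLeft i) < w (idxRight i) ∨ w (idxRight i) < w (idxLeft i) :=
  lt_or_gt_of_ne fun h => idxLeft_ne_idxRight i (w.injective h)

/-- A map on `Fin n` increasing at neighbours between `a` and `b` is increasing from `a` to `b`. -/
theorem apply_lt_of_consecutive {n : ℕ} {α : Type*} [Preorder α] (g : Fin n → α) {a b : Fin n}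
    (hab : a < b)
    (h : ∀ i : Fin (n - 1), a ≤ idxLeft i → idxRight i ≤ b → g (idxLeft i) < g (idxRight i)) :
    g a < g b := by
  obtain ⟨a, ha⟩ := a
  obtain ⟨b, hb⟩ := b
  have hab' : a + 1 ≤ b := hab
  clear hab
  induction b, hab' using Nat.le_induction with
  | base => exact h ⟨a, by omega⟩ le_rfl le_rfl
  | succ b hab ih =>
    refine (ih (by omega) fun i h1 h2 => h i h1 (h2.trans ?_)).trans
      (h ⟨b, by omega⟩ ?_ le_rfl)
    · simp
    · simp only [idxLeft, Fin.mk_le_mk]; omega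

theorem eq_one_of_increasing {n : ℕ} {w : Perm (Fin n)}
    (h : ∀ i : Fin (n - 1), w (idxLeft i) < w (idxRight i)) : w = 1 := by
  have hw : StrictMono w := fun a b hab => apply_lt_of_consecutive w hab fun i _ _ => h i
  have := (hw.range_inj strictMono_id).1 (by simp)
  ext k
  simp [this]

/-! ### Standard parabolic subgroups and descents -/

/-- The standard parabolic subgroup generated by the elementary transpositions in `J`. -/
def parabolic {n : ℕ} (J : Set (Fin (n - 1))) : Subgroup (Perm (Fin n)) :=
  Subgroup.closure (elemTransp '' J)

theorem elemTransp_mem_parabolic {n : ℕ} {J : Set (Fin (n - 1))} {i : Fin (n - 1)} (hi : i ∈ J) :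
    elemTransp i ∈ parabolic J := Subgroup.subset_closure ⟨i, hi, rfl⟩

theorem elemTransp_apply_le_iff {n : ℕ} {i j : Fin (n - 1)} (hij : j ≠ i) (a : Fin n) :
    elemTransp j a ≤ idxLeft i ↔ a ≤ idxLeft i := by
  have hij' : (j : ℕ) ≠ i := fun h => hij (Fin.ext h)
  by_cases hl : a = idxLeft j
  · subst hl
    rw [elemTransp_idxLeft]
    simp only [idxLeft, idxRight, Fin.mk_le_mk]; omega
  by_cases hr : a = idxRight j
  · subst hr
    rw [elemTransp_idxRight]
    simp only [idxLeft, idxRight, Fin.mk_le_mk]; omega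
  rw [elemTransp, swap_apply_of_ne_of_ne hl hr]

/-- Each generator `sⱼ` with `j ≠ i` stabilizes the initial segment ending at `i`. -/
theorem parabolic_apply_le_iff {n : ℕ} {J : Set (Fin (n - 1))} {w : Perm (Fin n)}
    (hw : w ∈ parabolic J) {i : Fin (n - 1)} (hi : i ∉ J) (a : Fin n) :
    w a ≤ idxLeft i ↔ a ≤ idxLeft i := by
  induction hw using Subgroup.closure_induction generalizing a with
  | mem x hx =>
    obtain ⟨j, hj, rfl⟩ := hx
    exact elemTransp_apply_le_iff (fun h => hi (by rwa [← h])) a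
  | one => rfl
  | mul x y _ _ hx hy => rw [Perm.mul_apply, hx, hy]
  | inv x _ hx => rw [← hx, apply_inv_apply]

theorem parabolic_apply_lt {n : ℕ} {J : Set (Fin (n - 1))} {w : Perm (Fin n)}
    (hw : w ∈ parabolic J) {i : Fin (n - 1)} (hi : i ∉ J) :
    w (idxLeft i) < w (idxRight i) :=
  lt_of_le_of_lt ((parabolic_apply_le_iff hw hi _).2 le_rfl)
    (not_le.1 fun h => (idxLeft_lt_idxRight i).not_ge ((parabolic_apply_le_iff hw hi _).1 h))

/-- An element of a standard parabolic subgroup without descents in `J` is the identity. -/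
theorem parabolic_eq_one {n : ℕ} {J : Set (Fin (n - 1))} {w : Perm (Fin n)}
    (hw : w ∈ parabolic J) (h : ∀ i ∈ J, w (idxLeft i) < w (idxRight i)) : w = 1 :=
  eq_one_of_increasing fun i => by
    by_cases hi : i ∈ J
    · exact h i hi
    · exact parabolic_apply_lt hw hi

/-- The left descents of a permutation. -/
def leftDescents {n : ℕ} (w : Perm (Fin n)) : Set (Fin (n - 1)) :=
  {i | w⁻¹ (idxRight i) < w⁻¹ (idxLeft i)}

/-- A descent of `x⁻¹` at `i ∈ D` is impossible: any `j ∉ D` between `x⁻¹ (i + 1)` and `x⁻¹ i` would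
bound a segment stabilized by `x` that separates them in the wrong order, so `w⁻¹` decreases
throughout that interval, against the descent of `x * w` at `i`. -/
theorem eq_one_of_subset_leftDescents {n : ℕ} {D : Set (Fin (n - 1))} {w x : Perm (Fin n)}
    (hx : x ∈ parabolic D) (hw : D ⊆ leftDescents w) (hxw : D ⊆ leftDescents (x * w)) : x = 1 := by
  rw [← inv_eq_one]
  refine parabolic_eq_one (inv_mem hx) fun i hi => ?_
  refine (apply_lt_or_gt x⁻¹ i).resolve_right fun hlt => ?_
  have h1 : w⁻¹ (x⁻¹ (idxRight i)) < w⁻¹ (x⁻¹ (idxLeft i)) := by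
    have := hxw hi
    simpa [leftDescents] using this
  refine lt_asymm h1 ?_
  refine apply_lt_of_consecutive (α := (Fin n)ᵒᵈ) (fun k => OrderDual.toDual (w⁻¹ k)) hlt
    fun j hj1 hj2 => ?_
  by_cases hj : j ∈ D
  · exact hw hj
  · exfalso
    have h2 := (parabolic_apply_le_iff hx hj (x⁻¹ (idxRight i))).2 hj1
    have h3 := (parabolic_apply_le_iff hx hj (x⁻¹ (idxLeft i))).not.2
      (not_le.2 (lt_of_lt_of_le (idxLeft_lt_idxRight j) hj2))
    rw [apply_inv_apply] at h2 h3
    exact h3 ((idxLeft_lt_idxRight i).le.trans h2)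

/-- A permutation `w` strictly minimizes the moment on its coset `W_D w`, where `D` is the set of
its left descents. -/
theorem moment_lt_of_mem_parabolic {n : ℕ} {w x : Perm (Fin n)}
    (hx : x ∈ parabolic (leftDescents w)) (hx1 : x ≠ 1) : moment w < moment (x * w) := by
  classical
  obtain ⟨y, hy, hmin⟩ := Finset.exists_min_image
    (Finset.univ.filter fun y => y ∈ parabolic (leftDescents w)) (fun y => moment (y * w))
    ⟨1, by simp [one_mem]⟩
  simp only [Finset.mem_filter, Finset.mem_univ, true_and] at hy hmin
  -- If `z * w` lacked a descent `i ∈ D`, then `sᵢ * z * w` would have a smaller moment than the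
  -- minimum.
  have hz : ∀ z ∈ parabolic (leftDescents w), moment (z * w) ≤ moment (y * w) → z = 1 := by
    intro z hz hle
    refine eq_one_of_subset_leftDescents hz subset_rfl fun i hi => ?_
    refine (apply_lt_or_gt (z * w)⁻¹ i).resolve_left fun hlt => ?_
    have h1 := moment_elemTransp_mul_lt hlt
    have h2 := hmin _ (mul_mem (elemTransp_mem_parabolic hi) hz)
    rw [mul_assoc] at h2
    omega
  have hy1 := hz y hy le_rfl
  by_contra hlt
  exact hx1 (hz x hx (by rw [hy1, one_mul]; omega))


/-! ### Right translations and sorting operators in the algebra -/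

@[simp] theorem linExt_single {n : ℕ} (φ : Perm (Fin n) → Perm (Fin n)) (μ : Perm (Fin n))
    (c : ℂ) : linExt φ (Finsupp.single μ c) = Finsupp.single (φ μ) c := by
  simp [linExt]

theorem end_ext {n : ℕ} {f g : Module.End ℂ (PermSpace n)}
    (h : ∀ μ, f (Finsupp.single μ 1) = g (Finsupp.single μ 1)) : f = g :=
  Finsupp.lhom_ext' fun μ => LinearMap.ext_ring (h μ)

theorem linExt_mul {n : ℕ} (φ ψ : Perm (Fin n) → Perm (Fin n)) :
    linExt φ * linExt ψ = linExt (φ ∘ ψ) := end_ext fun μ => by simp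

theorem linExt_id {n : ℕ} : linExt (id : Perm (Fin n) → Perm (Fin n)) = 1 :=
  end_ext fun μ => by simp

theorem sigmaOp_mem {n : ℕ} (i : Fin (n - 1)) : sigmaOp i ∈ HSAlgebra n :=
  Algebra.subset_adjoin (Or.inl ⟨i, rfl⟩)

theorem piOp_mem {n : ℕ} (i : Fin (n - 1)) : piOp i ∈ HSAlgebra n :=
  Algebra.subset_adjoin (Or.inr ⟨i, rfl⟩)

theorem HSAlgebra_sub_mem {n : ℕ} {f g : Module.End ℂ (PermSpace n)} (hf : f ∈ HSAlgebra n)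
    (hg : g ∈ HSAlgebra n) : f - g ∈ HSAlgebra n := by
  have : f - g = f + (-1 : ℂ) • g := by module
  rw [this]
  exact add_mem hf (Subalgebra.smul_mem _ hg _)

/-- Sorting the letters at the positions `i` and `i + 1` in increasing order. -/
def sortStep {n : ℕ} (i : Fin (n - 1)) (μ : Perm (Fin n)) : Perm (Fin n) :=
  if μ (idxRight i) < μ (idxLeft i) then μ * elemTransp i else μ

theorem linExt_sortStep_mem {n : ℕ} (i : Fin (n - 1)) : linExt (sortStep i) ∈ HSAlgebra n := by
  -- The increasing and decreasing sorts of `μ` are together `μ` and `μ sᵢ`.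
  have : linExt (sortStep i) = 1 + sigmaOp i - piOp i := end_ext fun μ => by
    by_cases h : μ (idxRight i) < μ (idxLeft i) <;> simp [sigmaOp, piOp, sortStep, h]
  rw [this]
  exact HSAlgebra_sub_mem (add_mem (one_mem _) (sigmaOp_mem i)) (piOp_mem i)

theorem linExt_mul_right_mem {n : ℕ} (u : Perm (Fin n)) :
    linExt (fun μ => μ * u) ∈ HSAlgebra n := by
  by_cases h : ∀ i : Fin (n - 1), u (idxLeft i) < u (idxRight i)
  · rw [eq_one_of_increasing h]
    have : (fun μ : Perm (Fin n) => μ * 1) = id := funext fun μ => mul_one μ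
    rw [this, linExt_id]
    exact one_mem _
  · push Not at h
    obtain ⟨i, hi⟩ := h
    have hi' : u (idxRight i) < u (idxLeft i) :=
      (apply_lt_or_gt u i).resolve_left (not_lt.2 hi)
    have hlt := moment_lt_mul_elemTransp hi'
    have hbound : ∀ w : Perm (Fin n), moment w ≤ ∑ v : Perm (Fin n), moment v := fun w =>
      Finset.single_le_sum (f := moment) (fun _ _ => Nat.zero_le _) (Finset.mem_univ w)
    have hb := hbound (u * elemTransp i)
    have : linExt (fun μ => μ * u) = sigmaOp i * linExt (fun μ => μ * (u * elemTransp i)) :=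
      end_ext fun μ => by simp [sigmaOp, mul_assoc]
    rw [this]
    exact mul_mem (sigmaOp_mem i) (linExt_mul_right_mem (u * elemTransp i))
termination_by (∑ v : Perm (Fin n), moment v) - moment u

/-- Some operator of `HSAlgebra n` sorts every permutation within its coset of a parabolic
subgroup acting on positions. -/
theorem exists_parabolic_sort {n : ℕ} (J : Set (Fin (n - 1))) :
    ∃ ψ : Perm (Fin n) → Perm (Fin n), linExt ψ ∈ HSAlgebra n ∧
      (∀ μ, μ⁻¹ * ψ μ ∈ parabolic J) ∧
      ∀ μ, ∀ i ∈ J, ψ μ (idxLeft i) < ψ μ (idxRight i) := by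
  classical
  -- With the total moment maximal, no descent in `J` can remain: one more sorting step would
  -- increase it.
  obtain ⟨ψ, hψ, hmax⟩ := Finset.exists_max_image
    (Finset.univ.filter fun ψ : Perm (Fin n) → Perm (Fin n) =>
      linExt ψ ∈ HSAlgebra n ∧ ∀ μ, μ⁻¹ * ψ μ ∈ parabolic J)
    (fun ψ => ∑ μ, moment (ψ μ))
    ⟨id, by simp [linExt_id, one_mem]⟩
  simp only [Finset.mem_filter, Finset.mem_univ, true_and] at hψ hmax
  refine ⟨ψ, hψ.1, hψ.2, fun μ i hi => ?_⟩
  refine (apply_lt_or_gt (ψ μ) i).resolve_right fun hlt => ?_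
  have hle : ∀ ν, moment ν ≤ moment (sortStep i ν) := fun ν => by
    unfold sortStep
    split_ifs with h
    · exact (moment_lt_mul_elemTransp h).le
    · exact le_rfl
  refine (hmax (sortStep i ∘ ψ) ⟨?_, fun ν => ?_⟩).not_gt ?_
  · rw [← linExt_mul]
    exact mul_mem (linExt_sortStep_mem i) hψ.1
  · simp only [Function.comp, sortStep]
    split_ifs
    · rw [← mul_assoc]
      exact mul_mem (hψ.2 ν) (elemTransp_mem_parabolic hi)
    · exact hψ.2 ν
  · refine Finset.sum_lt_sum (fun ν _ => hle _) ⟨μ, Finset.mem_univ _, ?_⟩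
    simp only [Function.comp, sortStep, if_pos hlt]
    exact moment_lt_mul_elemTransp hlt

/-! ### Antisymmetrizers and the basic rank one operators -/

open Classical in
/-- The coefficients of the antisymmetrizer of a parabolic subgroup. -/
noncomputable def antiCoeff {n : ℕ} (K : Set (Fin (n - 1))) (x : Perm (Fin n)) : ℂ :=
  if x ∈ parabolic K then ((Perm.sign x : ℤ) : ℂ) else 0

theorem antiCoeff_one {n : ℕ} (K : Set (Fin (n - 1))) : antiCoeff K 1 = 1 := by
  simp [antiCoeff, one_mem]

theorem antiCoeff_elemTransp_mul {n : ℕ} {K : Set (Fin (n - 1))} {i : Fin (n - 1)} (hi : i ∈ K)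
    (x : Perm (Fin n)) : antiCoeff K (elemTransp i * x) = -antiCoeff K x := by
  have hiff : elemTransp i * x ∈ parabolic K ↔ x ∈ parabolic K :=
    Subgroup.mul_mem_cancel_left _ (elemTransp_mem_parabolic hi)
  by_cases hx : x ∈ parabolic K
  · simp [antiCoeff, hiff.2 hx, hx]
  · simp [antiCoeff, hiff.not.2 hx, hx]

/-- Right multiplication by the antisymmetrizer of a parabolic subgroup. -/
noncomputable def antisymmetrizer {n : ℕ} (K : Set (Fin (n - 1))) :
    Module.End ℂ (PermSpace n) :=
  ∑ x, antiCoeff K x • linExt fun μ => μ * x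

theorem antisymmetrizer_mem {n : ℕ} (K : Set (Fin (n - 1))) : antisymmetrizer K ∈ HSAlgebra n :=
  sum_mem fun x _ => Subalgebra.smul_mem _ (linExt_mul_right_mem x) _

theorem antisymmetrizer_single {n : ℕ} (K : Set (Fin (n - 1))) (μ : Perm (Fin n)) :
    antisymmetrizer K (Finsupp.single μ 1) =
      ∑ x, antiCoeff K x • Finsupp.single (μ * x) 1 := by
  simp [antisymmetrizer]

theorem antisymmetrizer_single_mul_elemTransp {n : ℕ} {K : Set (Fin (n - 1))} {i : Fin (n - 1)}
    (hi : i ∈ K) (μ : Perm (Fin n)) :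
    antisymmetrizer K (Finsupp.single (μ * elemTransp i) 1) =
      -antisymmetrizer K (Finsupp.single μ 1) := by
  rw [antisymmetrizer_single, antisymmetrizer_single,
    ← Equiv.sum_comp (Equiv.mulLeft (elemTransp i)), ← Finset.sum_neg_distrib]
  refine Finset.sum_congr rfl fun x _ => ?_
  rw [Equiv.coe_mulLeft, antiCoeff_elemTransp_mul hi, ← mul_assoc, mul_elemTransp_cancel, neg_smul]

/-- The weights `k` for which the antisymmetrizer weighted by `k` belongs to `HSAlgebra n`. -/
def IsAntiWeight {n : ℕ} (K : Set (Fin (n - 1))) (k : Perm (Fin n) → ℕ) : Prop :=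
  ∃ T ∈ HSAlgebra n, ∀ μ, T (Finsupp.single μ 1) =
    (k μ : ℂ) • antisymmetrizer K (Finsupp.single μ 1)

/-- The effect of `1 - πᵢ` on weights. -/
def weightStep {n : ℕ} (i : Fin (n - 1)) (k : Perm (Fin n) → ℕ) (μ : Perm (Fin n)) : ℕ :=
  if μ (idxRight i) < μ (idxLeft i) then 0 else k μ + k (μ * elemTransp i)

/-- The factor `1 - πᵢ` kills `μ` at a descent and otherwise gives `μ - μ sᵢ`; the antisymmetrizer
changes sign under `sᵢ`, so the weights add. -/
theorem IsAntiWeight.step {n : ℕ} {K : Set (Fin (n - 1))} {k : Perm (Fin n) → ℕ}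
    (hk : IsAntiWeight K k) {i : Fin (n - 1)} (hi : i ∈ K) : IsAntiWeight K (weightStep i k) := by
  obtain ⟨T, hT, hTk⟩ := hk
  refine ⟨T * (1 - piOp i), mul_mem hT (HSAlgebra_sub_mem (one_mem _) (piOp_mem i)), fun μ => ?_⟩
  by_cases h : μ (idxRight i) < μ (idxLeft i)
  · simp [piOp, weightStep, h]
  · simp [piOp, weightStep, h, hTk, antisymmetrizer_single_mul_elemTransp hi, add_smul]

/-- Some weight vanishes at all permutations with a descent in `K`, but not at the identity. -/
theorem exists_antiWeight {n : ℕ} (K : Set (Fin (n - 1))) :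
    ∃ k : Perm (Fin n) → ℕ, IsAntiWeight K k ∧ 0 < k 1 ∧
      ∀ μ, (∃ i ∈ K, μ (idxRight i) < μ (idxLeft i)) → k μ = 0 := by
  classical
  -- Words are cleared by increasing moment, and at a given moment one index of `K` at a time.
  suffices H : ∀ m : ℕ, ∃ k : Perm (Fin n) → ℕ, IsAntiWeight K k ∧ 0 < k 1 ∧
      ∀ μ, (∃ i ∈ K, μ (idxRight i) < μ (idxLeft i)) → moment μ < m → k μ = 0 by
    obtain ⟨k, h1, h2, h3⟩ := H ((∑ v : Perm (Fin n), moment v) + 1)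
    exact ⟨k, h1, h2, fun μ hμ => h3 μ hμ (Nat.lt_succ_of_le
      (Finset.single_le_sum (f := moment) (fun _ _ => Nat.zero_le _) (Finset.mem_univ μ)))⟩
  intro m
  induction m with
  | zero => exact ⟨fun _ => 1, ⟨antisymmetrizer K, antisymmetrizer_mem K, by simp⟩, by simp,
      by simp⟩
  | succ m ih =>
    suffices H : ∀ I : Finset (Fin (n - 1)), ∃ k : Perm (Fin n) → ℕ, IsAntiWeight K k ∧ 0 < k 1 ∧
        (∀ μ, (∃ i ∈ K, μ (idxRight i) < μ (idxLeft i)) → moment μ < m → k μ = 0) ∧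
        ∀ μ, (∃ i ∈ K, i ∈ I ∧ μ (idxRight i) < μ (idxLeft i)) → moment μ = m → k μ = 0 by
      obtain ⟨k, h1, h2, h3, h4⟩ := H Finset.univ
      refine ⟨k, h1, h2, fun μ hμ hm => ?_⟩
      rcases Nat.lt_succ_iff_lt_or_eq.1 hm with hm | hm
      · exact h3 μ hμ hm
      · obtain ⟨i, hi, hd⟩ := hμ
        exact h4 μ ⟨i, hi, Finset.mem_univ i, hd⟩ hm
    intro I
    induction I using Finset.induction_on with
    | empty =>
      obtain ⟨k, h1, h2, h3⟩ := ih
      exact ⟨k, h1, h2, h3, by simp⟩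
    | insert i I _ ihI =>
      obtain ⟨k, h1, h2, h3, h4⟩ := ihI
      by_cases hi : i ∈ K
      -- The added weight sits at a word of smaller moment with a descent at `i`, already cleared;
      -- hence the zeros obtained so far survive.
      · have hnext : ∀ μ : Perm (Fin n), ¬ μ (idxRight i) < μ (idxLeft i) → moment μ ≤ m →
            k (μ * elemTransp i) = 0 := fun μ hμ hm => by
          have hlt := (apply_lt_or_gt μ i).resolve_right hμ
          exact h3 _ ⟨i, hi, by simpa using hlt⟩ ((moment_mul_elemTransp_lt hlt).trans_le hm)
        refine ⟨weightStep i k, h1.step hi, ?_, fun μ hμ hm => ?_, fun μ hμ hm => ?_⟩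
        -- Natural number weights cannot cancel, so the weight at 1 stays positive.
        · have : ¬ idxRight i < idxLeft i := (idxLeft_lt_idxRight i).not_gt
          simp [weightStep, this, h2]
        · unfold weightStep
          split_ifs with h
          · rfl
          · rw [hnext μ h hm.le, h3 μ hμ hm]
        · unfold weightStep
          split_ifs with h
          · rfl
          · rw [hnext μ h hm.le, h4 μ _ hm]
            obtain ⟨j, hj, hjI, hd⟩ := hμ
            rcases Finset.mem_insert.1 hjI with rfl | hjI
            · exact absurd hd h
            · exact ⟨j, hj, hjI, hd⟩
      · refine ⟨k, h1, h2, h3, fun μ hμ hm => h4 μ ?_ hm⟩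
        obtain ⟨j, hj, hjI, hd⟩ := hμ
        rcases Finset.mem_insert.1 hjI with rfl | hjI
        · exact absurd hj hi
        · exact ⟨j, hj, hjI, hd⟩

open Classical in
/-- The rank one operator projecting the indicator of a parabolic subgroup to the antisymmetrizer
of the complementary parabolic subgroup belongs to `HSAlgebra n`. -/
theorem exists_parabolic_rankOne {n : ℕ} (K : Set (Fin (n - 1))) :
    ∃ T ∈ HSAlgebra n, ∀ μ, T (Finsupp.single μ 1) =
      if μ ∈ parabolic Kᶜ then antisymmetrizer K (Finsupp.single 1 1) else 0 := by
  obtain ⟨ψ, hψ, hmem, hsort⟩ := exists_parabolic_sort Kᶜ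
  obtain ⟨k, ⟨T, hT, hTk⟩, hk1, hk0⟩ := exists_antiWeight K
  refine ⟨((k 1 : ℂ)⁻¹ • T) * linExt ψ, mul_mem (Subalgebra.smul_mem _ hT _) hψ, fun μ => ?_⟩
  have hk1' : (k 1 : ℂ) ≠ 0 := by exact_mod_cast hk1.ne'
  split_ifs with hμ
  · have h1 : ψ μ = 1 := by
      refine parabolic_eq_one ?_ (hsort μ)
      have := mul_mem hμ (hmem μ)
      rwa [mul_inv_cancel_left] at this
    simp [h1, hTk, smul_smul, hk1']
  · have h1 : ∃ i ∈ K, ψ μ (idxRight i) < ψ μ (idxLeft i) := by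
      by_contra hcon
      push Not at hcon
      have : ψ μ = 1 := eq_one_of_increasing fun i => by
        by_cases hi : i ∈ K
        · exact (apply_lt_or_gt _ i).resolve_right (not_lt.2 (hcon i hi))
        · exact hsort μ i hi
      have h2 := hmem μ
      rw [this, mul_one] at h2
      exact hμ (inv_mem_iff.1 h2)
    simp [hTk, hk0 _ h1]


/-! ### The basis of descent vectors -/

/-- The permutation `w` antisymmetrized on the left along its left descents. -/
noncomputable def descentVector {n : ℕ} (w : Perm (Fin n)) : PermSpace n :=
  linExt (fun μ => μ * w) (antisymmetrizer (leftDescents w) (Finsupp.single 1 1))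

theorem descentVector_eq_sum {n : ℕ} (w : Perm (Fin n)) :
    descentVector w = ∑ x, antiCoeff (leftDescents w) x • Finsupp.single (x * w) 1 := by
  simp [descentVector, antisymmetrizer_single]

theorem descentVector_isLeftAntisymmetric {n : ℕ} {w : Perm (Fin n)} {i : Fin (n - 1)}
    (hi : i ∈ leftDescents w) : IsLeftAntisymmetric i (descentVector w) := by
  unfold IsLeftAntisymmetric
  rw [descentVector_eq_sum, map_sum, ← Finset.sum_neg_distrib,
    ← Equiv.sum_comp (Equiv.mulLeft (elemTransp i))]
  refine Finset.sum_congr rfl fun x _ => ?_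
  rw [Equiv.coe_mulLeft, antiCoeff_elemTransp_mul hi, sigmaBarOp, map_smul, linExt_single,
    mul_assoc, elemTransp_mul_cancel, neg_smul]

theorem descentVector_apply {n : ℕ} (w y : Perm (Fin n)) :
    descentVector w y = antiCoeff (leftDescents w) (y * w⁻¹) := by
  classical
  rw [descentVector_eq_sum, Finsupp.finsetSum_apply, Finset.sum_eq_single (y * w⁻¹)]
  · simp
  · intro x _ hx
    have : x * w ≠ y := fun h => hx (by rw [← h, mul_inv_cancel_right])
    simp [this]
  · simp

theorem descentVector_apply_self {n : ℕ} (w : Perm (Fin n)) : descentVector w w = 1 := by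
  rw [descentVector_apply, mul_inv_cancel, antiCoeff_one]

theorem moment_lt_of_descentVector_ne_zero {n : ℕ} {w y : Perm (Fin n)} (hy : y ≠ w)
    (h : descentVector w y ≠ 0) : moment w < moment y := by
  rw [descentVector_apply, antiCoeff] at h
  have hmem : y * w⁻¹ ∈ parabolic (leftDescents w) := by
    by_contra hmem
    simp [hmem] at h
  have := moment_lt_of_mem_parabolic hmem fun h1 => hy (mul_inv_eq_one.1 h1)
  rwa [inv_mul_cancel_right] at this

theorem sigmaBarOp_apply {n : ℕ} (i : Fin (n - 1)) (v : PermSpace n) (y : Perm (Fin n)) :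
    sigmaBarOp i v (elemTransp i * y) = v y :=
  Finsupp.mapDomain_apply (mul_right_injective (elemTransp i)) v y

theorem IsLeftAntisymmetric.apply_elemTransp_mul {n : ℕ} {i : Fin (n - 1)} {v : PermSpace n}
    (hv : IsLeftAntisymmetric i v) (y : Perm (Fin n)) : v (elemTransp i * y) = -v y := by
  have h := sigmaBarOp_apply i v y
  rw [hv] at h
  rw [← h, Finsupp.neg_apply, neg_neg]

/-- A vector antisymmetric for all indices in `I` is a combination of the descent vectors of the
permutations whose left descents contain `I`. -/
theorem mem_span_descentVector {n : ℕ} (I : Set (Fin (n - 1))) (v : PermSpace n)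
    (hv : ∀ i ∈ I, IsLeftAntisymmetric i v) :
    v ∈ Submodule.span ℂ (descentVector '' {w | I ⊆ leftDescents w}) := by
  classical
  have key : ∀ s : Finset (Perm (Fin n)), (∀ w ∈ s, ∀ y, moment w < moment y → y ∈ s) →
      ∀ v : PermSpace n, (∀ i ∈ I, IsLeftAntisymmetric i v) → (∀ y, v y ≠ 0 → y ∈ s) →
      v ∈ Submodule.span ℂ (descentVector '' {w | I ⊆ leftDescents w}) := by
    intro s
    induction s using Finset.strongInduction with
    | H s ih =>
      -- The leading term at the `w` of least moment is eliminated; the rest of `descentVector w`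
      -- has larger moment, so the support stays in `s.erase w`.
      intro hs v hv hsupp
      rcases s.eq_empty_or_nonempty with rfl | hne
      · have : v = 0 := Finsupp.ext fun y => by
          by_contra hy
          exact absurd (hsupp y hy) (by simp)
        rw [this]
        exact zero_mem _
      obtain ⟨w, hw, hmin⟩ := Finset.exists_min_image s moment hne
      have hs' : ∀ u ∈ s.erase w, ∀ y, moment u < moment y → y ∈ s.erase w := by
        intro u hu y hy
        have hu' := Finset.mem_of_mem_erase hu
        refine Finset.mem_erase.2 ⟨?_, hs u hu' y hy⟩
        rintro rfl
        exact (hmin u hu').not_gt hy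
      by_cases hvw : v w = 0
      · refine ih _ (Finset.erase_ssubset hw) hs' v hv fun y hy => Finset.mem_erase.2
          ⟨?_, hsupp y hy⟩
        rintro rfl
        exact hy hvw
      -- Otherwise `sᵢ * w` would be in the support, by antisymmetry, with a smaller moment.
      · have hI : I ⊆ leftDescents w := fun i hi => by
          refine (apply_lt_or_gt w⁻¹ i).resolve_left fun hlt => ?_
          refine (hmin (elemTransp i * w) (hsupp _ ?_)).not_gt (moment_elemTransp_mul_lt hlt)
          rw [(hv i hi).apply_elemTransp_mul]
          exact neg_ne_zero.2 hvw
        have h1 : v w • descentVector w ∈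
            Submodule.span ℂ (descentVector '' {w | I ⊆ leftDescents w}) :=
          Submodule.smul_mem _ _ (Submodule.subset_span ⟨w, hI, rfl⟩)
        rw [← sub_add_cancel v (v w • descentVector w)]
        refine add_mem (ih _ (Finset.erase_ssubset hw) hs' _ (fun i hi => ?_) fun y hy => ?_) h1
        · have h2 := hv i hi
          have h3 := descentVector_isLeftAntisymmetric (hI hi)
          unfold IsLeftAntisymmetric at h2 h3 ⊢
          rw [map_sub, map_smul, h2, h3]
          module
        · have hyw : y ≠ w := by
            rintro rfl
            simp [descentVector_apply_self] at hy
          refine Finset.mem_erase.2 ⟨hyw, ?_⟩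
          by_cases h0 : descentVector w y = 0
          · exact hsupp y (by simpa [h0] using hy)
          · exact hs w hw y (moment_lt_of_descentVector_ne_zero hyw h0)
  exact key Finset.univ (by simp) v hv (by simp)

theorem span_descentVector (n : ℕ) :
    ⊤ ≤ Submodule.span ℂ (Set.range (descentVector (n := n))) := fun v _ => by
  have := mem_span_descentVector ∅ v (by simp)
  simpa using this

/-- The basis of `PermSpace n` made of the descent vectors. -/
noncomputable def descentBasis (n : ℕ) : Module.Basis (Perm (Fin n)) ℂ (PermSpace n) :=
  basisOfTopLeSpanOfCardEqFinrank descentVector (span_descentVector n) (by simp)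

theorem descentBasis_apply {n : ℕ} (w : Perm (Fin n)) : descentBasis n w = descentVector w := by
  simp [descentBasis]

theorem descentBasis_repr_eq_zero {n : ℕ} {i : Fin (n - 1)} {v : PermSpace n}
    (hv : IsLeftAntisymmetric i v) {w : Perm (Fin n)} (hi : i ∉ leftDescents w) :
    (descentBasis n).repr v w = 0 := by
  have h := mem_span_descentVector {i} v (by simpa using hv)
  have hb : (descentVector : Perm (Fin n) → PermSpace n) = descentBasis n :=
    funext fun w => (descentBasis_apply w).symm
  rw [hb, Module.Basis.mem_span_image] at h
  by_contra h0
  have := h (Finsupp.mem_support_iff.2 h0)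
  exact hi (this rfl)

/-! ### Sandwich equations and preservation by the generators -/

theorem sigmaBarOp_mul_self {n : ℕ} (i : Fin (n - 1)) :
    sigmaBarOp i * sigmaBarOp i = 1 := end_ext fun μ => by simp [sigmaBarOp]

theorem sigmaBarOp_sigmaBarOp {n : ℕ} (i : Fin (n - 1)) (v : PermSpace n) :
    sigmaBarOp i (sigmaBarOp i v) = v := LinearMap.congr_fun (sigmaBarOp_mul_self i) v

theorem isLeftAntisymmetric_sub {n : ℕ} (i : Fin (n - 1)) (v : PermSpace n) :
    IsLeftAntisymmetric i (v - sigmaBarOp i v) := by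
  unfold IsLeftAntisymmetric
  rw [map_sub, sigmaBarOp_sigmaBarOp, neg_sub]

theorem sandwichEq_iff {n : ℕ} (i : Fin (n - 1)) (f : Module.End ℂ (PermSpace n)) :
    SandwichEq i f ↔ ∀ v, IsLeftAntisymmetric i (f (v - sigmaBarOp i v)) := by
  have h2 : (1 / 2 : ℂ) ≠ 0 := by norm_num
  unfold SandwichEq IsLeftAntisymmetric
  rw [mul_smul_comm, smul_mul_assoc, smul_mul_assoc, smul_smul, smul_eq_zero_iff_right
    (mul_ne_zero h2 h2), LinearMap.ext_iff]
  refine forall_congr' fun v => ?_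
  rw [eq_neg_iff_add_eq_zero, add_comm]
  rfl

/-- The image of `1 - σ̄ᵢ` is exactly the space of left `i`-antisymmetric vectors, since such a `v`
equals `(1 - σ̄ᵢ)(v / 2)`. -/
theorem forall_sandwichEq_iff {n : ℕ} (f : Module.End ℂ (PermSpace n)) :
    (∀ i, SandwichEq i f) ↔ PreservesLeftAntisymmetries f := by
  refine forall_congr' fun i => ?_
  rw [sandwichEq_iff]
  refine ⟨fun h v hv => ?_, fun h v => h _ (isLeftAntisymmetric_sub i v)⟩
  have h1 := h ((1 / 2 : ℂ) • v)
  have h3 : (1 / 2 : ℂ) • v - sigmaBarOp i ((1 / 2 : ℂ) • v) = v := by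
    rw [map_smul, hv]
    module
  rwa [h3] at h1

theorem sandwichEq_of_single {n : ℕ} {i : Fin (n - 1)} {f : Module.End ℂ (PermSpace n)}
    (h : ∀ μ, IsLeftAntisymmetric i
      (f (Finsupp.single μ 1 - Finsupp.single (elemTransp i * μ) 1))) : SandwichEq i f := by
  rw [sandwichEq_iff]
  have : (1 + sigmaBarOp i) * f * (1 - sigmaBarOp i) = 0 := end_ext fun μ => by
    have := h μ
    unfold IsLeftAntisymmetric at this
    simp only [Module.End.mul_apply, LinearMap.sub_apply, LinearMap.add_apply,
      Module.End.one_apply, LinearMap.zero_apply]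
    rw [show sigmaBarOp i (Finsupp.single μ 1) = Finsupp.single (elemTransp i * μ) 1 from
      linExt_single _ _ _, this, add_neg_cancel]
  intro v
  have hv := LinearMap.congr_fun this v
  simp only [Module.End.mul_apply, LinearMap.sub_apply, LinearMap.add_apply,
      Module.End.one_apply, LinearMap.zero_apply] at hv
  exact eq_neg_of_add_eq_zero_right hv

theorem preserves_sigmaOp {n : ℕ} (i : Fin (n - 1)) :
    PreservesLeftAntisymmetries (sigmaOp i : Module.End ℂ (PermSpace n)) :=
  (forall_sandwichEq_iff _).1 fun j => sandwichEq_of_single fun μ => by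
    have := isLeftAntisymmetric_sub j (Finsupp.single (μ * elemTransp i) 1)
    simpa [sigmaOp, sigmaBarOp, mul_assoc] using this

/-- Exchanging the values `j` and `j + 1` preserves the comparison of two other letters. -/
theorem elemTransp_lt_elemTransp {n : ℕ} {j : Fin (n - 1)} {a b : Fin n} (hab : a < b)
    (h : ¬ (a = idxLeft j ∧ b = idxRight j)) : elemTransp j a < elemTransp j b := by
  have hab' : (a : ℕ) < b := hab
  have h' : ¬ ((a : ℕ) = j ∧ (b : ℕ) = j + 1) := fun hh => h ⟨Fin.ext hh.1, Fin.ext hh.2⟩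
  rw [Fin.lt_def]
  simp only [elemTransp, swap_apply_def, Fin.ext_iff]
  split_ifs <;> simp_all [idxLeft, idxRight] <;> omega

theorem preserves_piOp {n : ℕ} (i : Fin (n - 1)) :
    PreservesLeftAntisymmetries (piOp i : Module.End ℂ (PermSpace n)) :=
  (forall_sandwichEq_iff _).1 fun j => sandwichEq_of_single fun μ => by
    have hj : ∀ ν : Perm (Fin n), sigmaBarOp j (Finsupp.single ν 1) =
        Finsupp.single (elemTransp j * ν) 1 := fun ν => linExt_single _ _ _
    -- When the letters at `i`, `i + 1` are `j`, `j + 1`, both words have the same image under `πᵢ`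
    -- and the difference vanishes.
    have hcollapse : ∀ ν : Perm (Fin n), ν (idxLeft i) = idxLeft j → ν (idxRight i) = idxRight j →
        elemTransp j * ν = ν * elemTransp i := fun ν h1 h2 => by
      rw [elemTransp, elemTransp, ← h1, ← h2, Equiv.mul_swap_eq_swap_mul]
    simp only [piOp, map_sub, linExt_single]
    by_cases hc : μ (idxLeft i) = idxLeft j ∧ μ (idxRight i) = idxRight j
    · have hlt := idxLeft_lt_idxRight j
      rw [hcollapse μ hc.1 hc.2]
      simp [hc.1, hc.2, hlt, hlt.not_gt, IsLeftAntisymmetric]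
    by_cases hc' : μ (idxLeft i) = idxRight j ∧ μ (idxRight i) = idxLeft j
    · have hlt := idxLeft_lt_idxRight j
      have hcol : elemTransp j * μ * elemTransp i = μ := by
        rw [← hcollapse (elemTransp j * μ) (by simp [hc'.1]) (by simp [hc'.2]),
          elemTransp_mul_cancel]
      simp [hc'.1, hc'.2, hlt, hlt.not_gt, IsLeftAntisymmetric, hcol]
    rcases apply_lt_or_gt μ i with hlt | hlt
    · have : (elemTransp j * μ) (idxLeft i) < (elemTransp j * μ) (idxRight i) :=
        elemTransp_lt_elemTransp (j := j) hlt hc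
      rw [if_neg hlt.not_gt, if_neg this.not_gt, mul_assoc, ← hj]
      exact isLeftAntisymmetric_sub j _
    · have : (elemTransp j * μ) (idxRight i) < (elemTransp j * μ) (idxLeft i) :=
        elemTransp_lt_elemTransp (j := j) hlt fun h => hc' ⟨h.2, h.1⟩
      rw [if_pos hlt, if_pos this, ← hj]
      exact isLeftAntisymmetric_sub j _

theorem preserves_of_mem {n : ℕ} {f : Module.End ℂ (PermSpace n)} (hf : f ∈ HSAlgebra n) :
    PreservesLeftAntisymmetries f := by
  induction hf using Algebra.adjoin_induction with
  | mem f hf =>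
    rcases hf with ⟨i, rfl⟩ | ⟨i, rfl⟩
    · exact preserves_sigmaOp i
    · exact preserves_piOp i
  | algebraMap c =>
    intro i v hv
    unfold IsLeftAntisymmetric at hv ⊢
    rw [Module.algebraMap_end_apply, map_smul, hv, smul_neg]
  | add f g _ _ hf hg =>
    intro i v hv
    have h1 := hf i v hv
    have h2 := hg i v hv
    unfold IsLeftAntisymmetric at h1 h2 ⊢
    rw [LinearMap.add_apply, map_add, h1, h2, neg_add]
  | mul f g _ _ hf hg => exact fun i v hv => hf i _ (hg i v hv)

/-! ### Decomposition into rank one operators -/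

open Classical in
/-- The rank one operators pairing the indicator of a coset of a parabolic subgroup with a descent
vector belong to `HSAlgebra n`. -/
theorem exists_coset_rankOne {n : ℕ} (w t : Perm (Fin n)) :
    ∃ T ∈ HSAlgebra n, ∀ μ, T (Finsupp.single μ 1) =
      if μ * t⁻¹ ∈ parabolic (leftDescents w)ᶜ then descentVector w else 0 := by
  obtain ⟨T, hT, hTμ⟩ := exists_parabolic_rankOne (leftDescents w)
  refine ⟨linExt (fun μ => μ * w) * T * linExt (fun μ => μ * t⁻¹),
    mul_mem (mul_mem (linExt_mul_right_mem w) hT) (linExt_mul_right_mem _), fun μ => ?_⟩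
  simp only [Module.End.mul_apply, linExt_single, hTμ]
  split_ifs
  · rfl
  · simp

theorem mem_of_preserves {n : ℕ} {f : Module.End ℂ (PermSpace n)}
    (hf : PreservesLeftAntisymmetries f) : f ∈ HSAlgebra n := by
  classical
  choose T hT hTμ using exists_coset_rankOne (n := n)
  set φ : Perm (Fin n) → Perm (Fin n) → ℂ :=
    fun w μ => (descentBasis n).repr (f (Finsupp.single μ 1)) w
  -- For a generator `sᵢ`, the image of `μ - sᵢ μ` is left `i`-antisymmetric, so its coordinate at
  -- `w` is zero because `i` is not a left descent of `w`.
  have hinv : ∀ w x, x ∈ parabolic (leftDescents w)ᶜ → ∀ μ, φ w (x * μ) = φ w μ := by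
    intro w x hx
    induction hx using Subgroup.closure_induction with
    | mem x hx =>
      obtain ⟨i, hi, rfl⟩ := hx
      intro μ
      have h1 := hf i _ (isLeftAntisymmetric_sub i (Finsupp.single μ 1))
      have h2 := descentBasis_repr_eq_zero h1 hi
      rw [show sigmaBarOp i (Finsupp.single μ 1) = Finsupp.single (elemTransp i * μ) 1 from
        linExt_single _ _ _, map_sub, map_sub, Finsupp.sub_apply, sub_eq_zero] at h2
      exact h2.symm
    | one => simp
    | mul x y _ _ hx hy => intro μ; rw [mul_assoc, hx, hy]
    | inv x _ hx => intro μ; rw [← hx, mul_inv_cancel_left]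
  -- The sum below runs over all `t` instead of coset representatives, so each coset is counted as
  -- many times as the order `N w` of the subgroup.
  set N : Perm (Fin n) → ℂ := fun w => ∑ x, if x ∈ parabolic (leftDescents w)ᶜ then 1 else 0
  have hN : ∀ w, N w ≠ 0 := fun w => by
    simp only [N, Finset.sum_boole, Nat.cast_ne_zero]
    exact Finset.card_ne_zero_of_mem (a := 1) (by simp [one_mem])
  have hsum : f = ∑ w, ∑ t, ((N w)⁻¹ * φ w t) • T w t := end_ext fun μ => by
    rw [← (descentBasis n).sum_repr (f (Finsupp.single μ 1)), LinearMap.sum_apply]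
    refine Finset.sum_congr rfl fun w _ => ?_
    have h1 : ∀ t, (((N w)⁻¹ * φ w t) • T w t) (Finsupp.single μ 1) =
        ((N w)⁻¹ * φ w μ * if μ * t⁻¹ ∈ parabolic (leftDescents w)ᶜ then 1 else 0) •
          descentVector w := fun t => by
      rw [LinearMap.smul_apply, hTμ]
      split_ifs with h
      · rw [← hinv w _ h t, inv_mul_cancel_right, mul_one]
      · simp
    have h2 : N w = ∑ t, if μ * t⁻¹ ∈ parabolic (leftDescents w)ᶜ then (1 : ℂ) else 0 := by
      rw [← Equiv.sum_comp ((Equiv.inv _).trans (Equiv.mulRight μ))]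
      simp [N]
    rw [LinearMap.sum_apply, Finset.sum_congr rfl fun t _ => h1 t, ← Finset.sum_smul,
      ← Finset.mul_sum, ← h2, descentBasis_apply, mul_right_comm, inv_mul_cancel₀ (hN w), one_mul]
  rw [hsum]
  exact sum_mem fun w _ => sum_mem fun t _ => Subalgebra.smul_mem _ (hT w t) _

theorem theorem3p2 (n : ℕ) :
    (HSAlgebra n : Set (Module.End ℂ (PermSpace n))) = {f | ∀ i : Fin (n - 1), SandwichEq i f} ∧
    (HSAlgebra n : Set (Module.End ℂ (PermSpace n))) = {f | PreservesLeftAntisymmetries f} := by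
  have h : (HSAlgebra n : Set (Module.End ℂ (PermSpace n))) =
      {f | PreservesLeftAntisymmetries f} :=
    Set.ext fun f => ⟨preserves_of_mem, mem_of_preserves⟩
  exact ⟨h.trans (Set.ext fun f => (forall_sandwichEq_iff f).symm), h⟩
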